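/- Let $X$ be a smooth (Hausdorff, second countable) 2-dimensional manifold without boundary, $\pi_X:T^\star X\to X$ its cotangent bundle with the canonical symplectic structure, $H:T^\star X\to\mathbb R$ a smooth Hamiltonian with Hamiltonian vector field $\vec H$, $E\in\mathbb R$, $\Sigma:=H^{-1}(E)$, $A\in X$ and $\Sigma^A:=\Sigma\cap T^\star_AX$. Assume that $H^{-1}([E-a,E+a])$ is compact for some $a>0$, that $dH$ does not vanish on $\Sigma$, and that $d(H_{|T^\star_AX})$ does not vanish on $\Sigma^A$. Assume that $H$ is integrable near $E$: for some $b>0$ there is a smooth map $M=(I,J):W\to\mathbb R^2$ on $W:=H^{-1}(]E-b,E+b[)$ such that $\{I,J\}=0$, the set of points of $W$ where $dI,dJ$ are linearly dependent has measure $0$, and $H=\Phi(I,J)$ on $W$ for some smooth function $\Phi:M(W)\to\mathbb R$. Assume moreover the Morse–Bott condition: at any point $z\in\Sigma$ with $\lambda\,dI+\mu\,dJ=0$ for some $(\lambda,\mu)\neq(0,0)$, the critical points of $(\lambda I+\mu J)_{|\Sigma}$ near $z$ form a 1-dimensional submanifold, and the Hessian of $(\lambda I+\mu J)_{|\Sigma}$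 at $z$ is transversally non-degenerate, i.e. its kernel is the tangent space of that submanifold. Let $Z_0\subset\Sigma$ be the set of points of $\Sigma$ where $dI$ and $dJ$ are linearly dependent, and let $Z\subset\Sigma$ be the union of $Z_0$ and of all the stable and unstable manifolds of the hyperbolic periodic orbits of $\vec H$ contained in $Z_0$ (those whose transversal Hessian is indefinite). The open set $\Sigma\setminus Z_0$ is foliated by Lagrangian leaves, the connected components of the level sets of $M$ in $\Sigma\setminus Z_0$. The caustic set of a Lagrangian manifold $\Lambda\subset T^\star X$ is the set of critical points of $(\pi_X)_{|\Lambda}$. If there is only a finite number of points $\omega\in\Sigma^A\cap(Z\setminus Z_0)$ such that $(A,\omega)$ belongs to the caustic set of the Lagrangian leaf in which it lives, then $\Sigma^A\cap Z$ is a countable set. -/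

import Mathlib

open Set Filter Topology MeasureTheory Bundle
open scoped Manifold ContDiff

noncomputable section

namespace WaveFront

/-- The Euclidean plane, on which surfaces are modelled. -/
abbrev Plane : Type := EuclideanSpace ℝ (Fin 2)

/-- The model `T*ℝ² = ℝ² × (ℝ²)*` of a cotangent bundle: pairs (position, momentum). -/
abbrev Phase : Type := Plane × (Plane →L[ℝ] ℝ)

section

variable (X : Type*) [TopologicalSpace X] [ChartedSpace Plane X]

/-- The cotangent space `T*_x X`. -/
abbrev CotangentSpace (x : X) : Type := TangentSpace (𝓡 2) x →L[ℝ] Bundle.Trivial X ℝ x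

/-- The cotangent bundle `T*X` of a surface `X` (with Mathlib's vector bundle topology and
smooth structure on bundles of continuous linear maps). -/
abbrev CotangentBundle : Type _ := TotalSpace (Plane →L[ℝ] ℝ) (CotangentSpace X)

end

/-- The model with corners of `T*X`, a boundaryless smooth manifold of dimension 4. -/
abbrev phaseModel : ModelWithCorners ℝ Phase (ModelProd Plane (Plane →L[ℝ] ℝ)) :=
  (𝓡 2).prod 𝓘(ℝ, Plane →L[ℝ] ℝ)

variable {X : Type*} [TopologicalSpace X] [ChartedSpace Plane X] [IsManifold (𝓡 2) ∞ X]

/-- The charts of `T*X` are the canonical ones: the chart at `z` maps a covector `(x, ξ)` to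
`(q, p)`, where `q` is the coordinate of `x` in the chart of `X` at `π_X z` and `p = ξ ∘ (dq)⁻¹`
is the covector `ξ` expressed in that chart. -/
theorem extChartAt_cotangent (z w : CotangentBundle X) :
    extChartAt phaseModel z w =
      (extChartAt (𝓡 2) z.proj w.proj,
        (w.2 : TangentSpace (𝓡 2) w.proj →L[ℝ] ℝ) ∘L
          (trivializationAt Plane (TangentSpace (𝓡 2)) z.proj).symmL ℝ w.proj) := by
  have h := hom_chart (𝕜 := ℝ) (HB := Plane) (F₁ := Plane) (F₂ := ℝ) (E₁ := (TangentSpace (𝓡 2) : X → Type))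
    (E₂ := Bundle.Trivial X ℝ) z w
  have h' : extChartAt phaseModel z w =
    (extChartAt (𝓡 2) z.proj w.proj, (chartAt (ModelProd Plane (Plane →L[ℝ] ℝ)) z w).2) := by
    rfl
  rw [h', h]
  refine Prod.ext rfl ?_
  simp only [ContinuousLinearMap.inCoordinates, Bundle.Trivial.fiberBundle_trivializationAt',
    Bundle.Trivial.continuousLinearMapAt_trivialization]
  rfl

/-- The differential of a function at a point of `T*X`, as a linear form on `T_z(T*X)`. -/
def diff (f : CotangentBundle X → ℝ) (z : CotangentBundle X) : Phase →L[ℝ] ℝ :=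
  mfderiv phaseModel 𝓘(ℝ, ℝ) f z

/-- The differential at `z` of the canonical projection `π_X : T*X → X`. -/
def diffProj (z : CotangentBundle X) : Phase →L[ℝ] Plane :=
  mfderiv phaseModel (𝓡 2) (fun w : CotangentBundle X => w.proj) z

/-- The Hamiltonian vector field `(∂H/∂ξ, -∂H/∂x)` of `H` for the canonical symplectic form of
`T*X`. By definition `T_z(T*X)` is read in the chart of `T*X` at `z`, which is a canonical
(Darboux) chart, so that this is the usual formula in canonical coordinates. -/
def hamiltonianField (H : CotangentBundle X → ℝ) (z : CotangentBundle X) :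
    TangentSpace phaseModel z :=
  ((WithLp.toLp 2 fun i => diff H z (0, EuclideanSpace.proj i),
    -(diff H z ∘L ContinuousLinearMap.inl ℝ Plane (Plane →L[ℝ] ℝ))) : Phase)

/-- The Poisson bracket `{f, g} = ∑ i, ∂f/∂ξ_i ∂g/∂x_i - ∂f/∂x_i ∂g/∂ξ_i`, that is, the
derivative of `g` along the Hamiltonian vector field of `f`. -/
def poissonBracket (f g : CotangentBundle X → ℝ) (z : CotangentBundle X) : ℝ :=
  diff g z (hamiltonianField f z)

set_option synthInstance.maxHeartbeats 200000 in
/-- The second derivative of `f` at `z`, in the chart of `T*X` at `z`. If `df(z) = 0` this is the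
Hessian of `f` at `z`, a bilinear form on `T_z(T*X)` that does not depend on the chart. -/
def hessian (f : CotangentBundle X → ℝ) (z : CotangentBundle X) :
    Phase →L[ℝ] Phase →L[ℝ] ℝ :=
  fderiv ℝ (fderiv ℝ (f ∘ (extChartAt phaseModel z).symm)) (extChartAt phaseModel z z)

/-- A subset of the 4-manifold `T*X` of measure zero: it is Lebesgue null in every chart. -/
def IsNull (N : Set (CotangentBundle X)) : Prop :=
  ∀ z : CotangentBundle X,
    (Measure.addHaar : Measure Phase)
      (extChartAt phaseModel z '' (N ∩ (extChartAt phaseModel z).source)) = 0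

/-- `z` is a critical point of the moment map `(I, J)`: `dI` and `dJ` are linearly dependent. -/
def IsMomentCritical (I J : CotangentBundle X → ℝ) (z : CotangentBundle X) : Prop :=
  ∃ l m : ℝ, (l, m) ≠ (0, 0) ∧ l • diff I z + m • diff J z = 0

/-- The energy shell `Σ = H⁻¹(E)`. -/
def shell (H : CotangentBundle X → ℝ) (E : ℝ) : Set (CotangentBundle X) := {z | H z = E}

/-- `Σ^A`, the part of the energy shell that lies over the point `A`. -/
def shellAt (H : CotangentBundle X → ℝ) (E : ℝ) (A : X) : Set (CotangentBundle X) :=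
  {z | z ∈ shell H E ∧ z.proj = A}

/-- `H` is integrable on `H⁻¹(]E - b, E + b[)`, with moment map `(I, J)`. -/
structure IsIntegrableNear (H I J : CotangentBundle X → ℝ) (E b : ℝ) : Prop where
  pos : 0 < b
  smooth_left : ContMDiffOn phaseModel 𝓘(ℝ, ℝ) ∞ I (H ⁻¹' Ioo (E - b) (E + b))
  smooth_right : ContMDiffOn phaseModel 𝓘(ℝ, ℝ) ∞ J (H ⁻¹' Ioo (E - b) (E + b))
  commute : ∀ z ∈ H ⁻¹' Ioo (E - b) (E + b), poissonBracket I J z = 0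
  null_critical : IsNull {z | z ∈ H ⁻¹' Ioo (E - b) (E + b) ∧ IsMomentCritical I J z}
  factor : ∃ Φ : ℝ × ℝ → ℝ,
    ContDiffOn ℝ ∞ Φ ((fun z => (I z, J z)) '' (H ⁻¹' Ioo (E - b) (E + b))) ∧
    ∀ z ∈ H ⁻¹' Ioo (E - b) (E + b), H z = Φ (I z, J z)

/-- The critical points of the restriction of `f` to the energy shell `Σ` of `H`: the points of
`Σ` where `df` vanishes on `TΣ = ker dH`. -/
def shellCritical (H : CotangentBundle X → ℝ) (E : ℝ) (f : CotangentBundle X → ℝ) :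
    Set (CotangentBundle X) :=
  {w | w ∈ shell H E ∧ ∀ v, diff H w v = 0 → diff f w v = 0}

/-- Near `z`, where `df = 0`, the critical points of `f` restricted to `Σ` form a submanifold `C`
of dimension 1 (the zero set of a submersion `F` of a neighbourhood of `z` in the 4-manifold `T*X`
to `ℝ³`), and the Hessian at `z` of the restriction of `f` to `Σ` is transversally
non-degenerate: its kernel in `T_zΣ = ker dH` is exactly `T_zC = ker dF`. -/
def IsMorseBottAt (H : CotangentBundle X → ℝ) (E : ℝ) (f : CotangentBundle X → ℝ)
    (z : CotangentBundle X) : Prop :=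
  ∃ (U : Set (CotangentBundle X)) (F : CotangentBundle X → EuclideanSpace ℝ (Fin 3)),
    IsOpen U ∧ z ∈ U ∧ ContMDiffOn phaseModel (𝓡 3) ∞ F U ∧
    Function.Surjective (mfderiv phaseModel (𝓡 3) F z) ∧
    (∀ w ∈ U, w ∈ shellCritical H E f ↔ F w = 0) ∧
    ∀ u : Phase, mfderiv phaseModel (𝓡 3) F z u = 0 ↔
      (diff H z u = 0 ∧ ∀ v : Phase, diff H z v = 0 → hessian f z u v = 0)

/-- The Morse-Bott condition (A1) on the moment map `(I, J)` along the energy shell. -/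
def MorseBott (H I J : CotangentBundle X → ℝ) (E : ℝ) : Prop :=
  ∀ z ∈ shell H E, ∀ l m : ℝ, (l, m) ≠ (0, 0) → l • diff I z + m • diff J z = 0 →
    IsMorseBottAt H E (fun w => l * I w + m * J w) z

/-- The singular set `Z₀`: the critical points of the moment map on the energy shell. -/
def singularSet (H I J : CotangentBundle X → ℝ) (E : ℝ) : Set (CotangentBundle X) :=
  {z | z ∈ shell H E ∧ IsMomentCritical I J z}

/-- The transversal Hessian at a point `z` of `Z₀` has signature `(1, 1)`: the Hessian at `z` of
`λI + μJ` restricted to `Σ`, where `λ dI + μ dJ = 0` at `z`, takes both signs. -/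
def IsHyperbolicAt (H I J : CotangentBundle X → ℝ) (z : CotangentBundle X) : Prop :=
  ∃ l m : ℝ, (l, m) ≠ (0, 0) ∧ l • diff I z + m • diff J z = 0 ∧
    ∃ u v : Phase, diff H z u = 0 ∧ diff H z v = 0 ∧
      hessian (fun w => l * I w + m * J w) z u u < 0 ∧
      0 < hessian (fun w => l * I w + m * J w) z v v

/-- `γ` is a periodic orbit of the Hamiltonian vector field of `H`, contained in `Z₀`, and
hyperbolic (as opposed to elliptic) according to the signature of the transversal Hessian. -/
def IsHyperbolicOrbit (H I J : CotangentBundle X → ℝ) (E : ℝ)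
    (γ : Set (CotangentBundle X)) : Prop :=
  (∃ (c : ℝ → CotangentBundle X) (T : ℝ), 0 < T ∧ Function.Periodic c T ∧
    IsMIntegralCurve (I := phaseModel) c (hamiltonianField H) ∧ γ = range c) ∧
  γ ⊆ singularSet H I J E ∧ ∀ z ∈ γ, IsHyperbolicAt H I J z

/-- The stable manifold of `γ`: the points whose Hamiltonian trajectory tends to `γ` as
`t → +∞`. -/
def stableManifold (H : CotangentBundle X → ℝ) (γ : Set (CotangentBundle X)) :
    Set (CotangentBundle X) :=
  {z | ∃ c : ℝ → CotangentBundle X,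
    IsMIntegralCurve (I := phaseModel) c (hamiltonianField H) ∧ c 0 = z ∧
    Tendsto c atTop (𝓝ˢ γ)}

/-- The unstable manifold of `γ`: the points whose Hamiltonian trajectory tends to `γ` as
`t → -∞`. -/
def unstableManifold (H : CotangentBundle X → ℝ) (γ : Set (CotangentBundle X)) :
    Set (CotangentBundle X) :=
  {z | ∃ c : ℝ → CotangentBundle X,
    IsMIntegralCurve (I := phaseModel) c (hamiltonianField H) ∧ c 0 = z ∧
    Tendsto c atBot (𝓝ˢ γ)}

/-- The set `Z`: the union of `Z₀` and of all the stable and unstable manifolds of the hyperbolic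
periodic orbits. -/
def separatrixSet (H I J : CotangentBundle X → ℝ) (E : ℝ) : Set (CotangentBundle X) :=
  singularSet H I J E ∪
    ⋃ γ ∈ {γ | IsHyperbolicOrbit H I J E γ}, (stableManifold H γ ∪ unstableManifold H γ)

/-- The leaf through `z` of the Lagrangian foliation of `Σ ∖ Z₀` by the level sets of the moment
map: the connected component of `z` in the level set. -/
def leaf (H I J : CotangentBundle X → ℝ) (E : ℝ) (z : CotangentBundle X) :
    Set (CotangentBundle X) :=
  connectedComponentIn
    {w | w ∈ shell H E \ singularSet H I J E ∧ I w = I z ∧ J w = J z} z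

/-- The tangent vectors at `z` of a submanifold `L` of `T*X`: the velocities at `z` of the smooth
curves drawn on `L`. -/
def tangentVectors (L : Set (CotangentBundle X)) (z : CotangentBundle X) : Set Phase :=
  {v | ∃ c : ℝ → CotangentBundle X, ContMDiff 𝓘(ℝ, ℝ) phaseModel ∞ c ∧ (∀ t, c t ∈ L) ∧
    c 0 = z ∧ (mfderiv 𝓘(ℝ, ℝ) phaseModel c 0 : ℝ →L[ℝ] Phase) 1 = v}

/-- The caustic set of a Lagrangian submanifold `L` of `T*X`: the critical points of the
restriction to `L` of the projection `π_X`, that is, the points of `L` at which the differential of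
this restriction is not onto. -/
def causticSet (L : Set (CotangentBundle X)) : Set (CotangentBundle X) :=
  {z | z ∈ L ∧ ¬ ∀ u : Plane, ∃ v ∈ tangentVectors L z, diffProj z v = u}

/-- Assumption (A3) on the point `A`: the intersection of `Σ^A` with `Z` is countable. -/
def CountableSeparatrix (H I J : CotangentBundle X → ℝ) (E : ℝ) (A : X) : Prop :=
  (shellAt H E A ∩ separatrixSet H I J E).Countable

end WaveFront

end

noncomputable section

namespace WaveFront

/-! Since `T*X` is second countable, a set all of whose points are isolated is countable. The set
`Σ^A ∩ Z` is covered by `Σ^A ∩ Z₀`, the finitely many caustic points, and the remaining non-caustic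
points on stable and unstable manifolds.

On `Z₀`: let `f = λI + μJ` have zero differential at `z`. By Morse-Bott, `Z₀` lies near `z` in a
curve whose tangent at `z` is the kernel of the Hessian of `f` on `Σ`. As `f` Poisson-commutes with
`H`, this kernel contains the Hamiltonian vector of `H` (`hessian_hamiltonianField`), hence is
spanned by it. Its projection to `X` is `∂H/∂ξ`, nonzero over `A`, so the curve is transverse to the
fibre and `z` is isolated (`isolated_singular_of_not_vertical`).

Off `Z₀`: by continuity `M = (I, J)` takes on a stable or unstable manifold its value on the orbit.
Each orbit is open in `Z₀`, so only countably many values occur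
(`countable_moment_hyperbolicOrbits`). For a fixed value, a non-caustic point is isolated in the
fibre, because the tangent plane of its leaf is transverse to the fibre
(`isolated_of_notMem_causticSet`). -/

/-! ### Countability from isolation, and local injectivity -/

theorem countable_image_of_locally_const {α β : Type*} [TopologicalSpace α]
    [SecondCountableTopology α] {S : Set α} {g : α → β}
    (h : ∀ z ∈ S, ∃ N ∈ 𝓝 z, ∀ w ∈ N, w ∈ S → g w = g z) : (g '' S).Countable := by
  choose! N hN hg using h
  obtain ⟨t, htS, htc, hcov⟩ := TopologicalSpace.countable_cover_nhdsWithin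
    (f := N) (s := S) fun z hz => mem_nhdsWithin_of_mem_nhds (hN z hz)
  refine (htc.image g).mono ?_
  rintro _ ⟨w, hw, rfl⟩
  obtain ⟨z, hz, hwz⟩ := mem_iUnion₂.1 (hcov hw)
  exact ⟨z, hz, (hg z (htS hz) w hwz hw).symm⟩

theorem countable_of_isolated {α : Type*} [TopologicalSpace α] [SecondCountableTopology α]
    {S : Set α} (h : ∀ z ∈ S, ∃ N ∈ 𝓝 z, ∀ w ∈ N, w ∈ S → w = z) : S.Countable := by
  simpa using countable_image_of_locally_const (g := id) h

/-- Composing `f` with a linear left inverse of `f'` gives a map with identity derivative, to which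
the inverse function theorem applies. -/
theorem _root_.HasStrictFDerivAt.exists_nhds_injOn {V W : Type*} [NormedAddCommGroup V]
    [NormedSpace ℝ V] [FiniteDimensional ℝ V] [NormedAddCommGroup W] [NormedSpace ℝ W]
    [FiniteDimensional ℝ W]
    {f : V → W} {f' : V →L[ℝ] W} {x : V} (hf : HasStrictFDerivAt f f' x)
    (hinj : ∀ u, f' u = 0 → u = 0) : ∃ N ∈ 𝓝 x, InjOn f N := by
  have : CompleteSpace V := FiniteDimensional.complete ℝ V
  obtain ⟨g, hg⟩ := (f' : V →ₗ[ℝ] W).exists_leftInverse_of_injective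
    (LinearMap.ker_eq_bot'.2 fun u hu => hinj u hu)
  have h1 : HasStrictFDerivAt (g.toContinuousLinearMap ∘ f)
      ((ContinuousLinearEquiv.refl ℝ V : V ≃L[ℝ] V) : V →L[ℝ] V) x := by
    have h2 := (g.toContinuousLinearMap.hasStrictFDerivAt (x := f x)).comp x hf
    have h3 : g.toContinuousLinearMap ∘L f' = (ContinuousLinearEquiv.refl ℝ V : V ≃L[ℝ] V) :=
      ContinuousLinearMap.ext fun u => congrArg (fun k : V →ₗ[ℝ] V => k u) hg
    rw [h3] at h2
    exact h2
  refine ⟨_, (h1.toOpenPartialHomeomorph _).open_source.mem_nhds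
    h1.mem_toOpenPartialHomeomorph_source, fun a ha b hb hab => ?_⟩
  exact (h1.toOpenPartialHomeomorph _).injOn ha hb (congrArg g hab)

/-! ### Calculus in the charts of the cotangent bundle -/

variable {X : Type*} [TopologicalSpace X] [ChartedSpace Plane X] [IsManifold (𝓡 2) ∞ X]

/-- Chart domains of `T*X` are preimages of chart domains of `X`, so a countable atlas lifts, with
charts centred at zero covectors. -/
theorem secondCountableTopology_cotangentBundle [SecondCountableTopology X] :
    SecondCountableTopology (CotangentBundle X) := by
  obtain ⟨t, htc, hcov⟩ := TopologicalSpace.countable_cover_nhds (α := X)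
    (f := fun x => (chartAt Plane x).source) fun x => chart_source_mem_nhds _ x
  have : SecondCountableTopology (ModelProd Plane (Plane →L[ℝ] ℝ)) :=
    inferInstanceAs (SecondCountableTopology (Plane × (Plane →L[ℝ] ℝ)))
  refine ChartedSpace.secondCountable_of_countable_cover (ModelProd Plane (Plane →L[ℝ] ℝ))
    (s := (fun x => (⟨x, 0⟩ : CotangentBundle X)) '' t) ?_ (htc.image _)
  refine eq_univ_of_forall fun w => ?_
  obtain ⟨x, hx, hw⟩ := mem_iUnion₂.1 (hcov.ge (mem_univ w.proj))
  refine mem_iUnion₂.2 ⟨_, mem_image_of_mem _ hx, ?_⟩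
  rw [FiberBundle.chartedSpace_chartAt]
  simp [hw]

theorem mem_extChartAt_source_iff (z w : CotangentBundle X) :
    w ∈ (extChartAt phaseModel z).source ↔ w.proj ∈ (extChartAt (𝓡 2) z.proj).source := by
  rw [FiberBundle.extChartAt]
  simp only [PartialEquiv.trans_source, PartialEquiv.prod_source, PartialEquiv.refl_source,
    mem_inter_iff, mem_preimage, mem_prod, mem_univ, and_true]
  refine ⟨fun h => ?_, fun h => ?_⟩
  · have := h.2
    rwa [show ((trivializationAt (Plane →L[ℝ] ℝ) (CotangentSpace X) z.proj).toPartialEquiv w).1 =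
      w.proj from (trivializationAt (Plane →L[ℝ] ℝ) (CotangentSpace X) z.proj).coe_fst h.1] at this
  · have h1 : w ∈ (trivializationAt (Plane →L[ℝ] ℝ) (CotangentSpace X) z.proj).source := by
      rw [Trivialization.mem_source, hom_trivializationAt_baseSet]
      simpa using h
    refine ⟨h1, ?_⟩
    rwa [show ((trivializationAt (Plane →L[ℝ] ℝ) (CotangentSpace X) z.proj).toPartialEquiv w).1 =
      w.proj from (trivializationAt (Plane →L[ℝ] ℝ) (CotangentSpace X) z.proj).coe_fst h1]

theorem mfderiv_eq_fderiv {V : Type*} [NormedAddCommGroup V] [NormedSpace ℝ V]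
    {f : CotangentBundle X → V} {z : CotangentBundle X}
    (hf : MDifferentiableAt phaseModel 𝓘(ℝ, V) f z) :
    mfderiv phaseModel 𝓘(ℝ, V) f z =
      fderiv ℝ (f ∘ (extChartAt phaseModel z).symm) (extChartAt phaseModel z z) := by
  rw [hf.mfderiv]
  simp [writtenInExtChartAt]
  rfl

theorem contDiffAt_of_contMDiffAt {V : Type*} [NormedAddCommGroup V] [NormedSpace ℝ V]
    {f : CotangentBundle X → V} {z w : CotangentBundle X}
    (hw : w ∈ (extChartAt phaseModel z).source)
    (hf : ContMDiffAt phaseModel 𝓘(ℝ, V) ∞ f w) :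
    ContDiffAt ℝ ∞ (f ∘ (extChartAt phaseModel z).symm) (extChartAt phaseModel z w) := by
  have h1 : ContMDiffAt 𝓘(ℝ, Phase) phaseModel ∞ (extChartAt phaseModel z).symm
      (extChartAt phaseModel z w) :=
    (contMDiffOn_extChartAt_symm z).contMDiffAt
      ((isOpen_extChartAt_target z).mem_nhds ((extChartAt phaseModel z).map_source hw))
  refine contMDiffAt_iff_contDiffAt.1 (ContMDiffAt.comp _ ?_ h1)
  rwa [(extChartAt phaseModel z).left_inv hw]

/-- The source of every isolation statement below: `f` is a local equation of a curve or the moment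
map, `g` a coordinate transverse to what must be separated. -/
theorem exists_nhds_injective {V W : Type*} [NormedAddCommGroup V] [NormedSpace ℝ V]
    [FiniteDimensional ℝ V] [NormedAddCommGroup W] [NormedSpace ℝ W] [FiniteDimensional ℝ W]
    {f : CotangentBundle X → V} {g : CotangentBundle X → W} {z : CotangentBundle X}
    (hf : ContMDiffAt phaseModel 𝓘(ℝ, V) ∞ f z) (hg : ContMDiffAt phaseModel 𝓘(ℝ, W) ∞ g z)
    (hinj : ∀ u : Phase, mfderiv phaseModel 𝓘(ℝ, V) f z u = 0 →
      mfderiv phaseModel 𝓘(ℝ, W) g z u = 0 → u = 0) :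
    ∃ N ∈ 𝓝 z, ∀ w ∈ N, ∀ w' ∈ N, f w = f w' → g w = g w' → w = w' := by
  rw [mfderiv_eq_fderiv (hf.mdifferentiableAt (by simp)),
    mfderiv_eq_fderiv (hg.mdifferentiableAt (by simp))] at hinj
  have h1 := ((contDiffAt_of_contMDiffAt (mem_extChartAt_source z) hf).hasStrictFDerivAt
    (by simp)).prodMk ((contDiffAt_of_contMDiffAt (mem_extChartAt_source z) hg).hasStrictFDerivAt
    (by simp))
  obtain ⟨N, hN, hi⟩ := h1.exists_nhds_injOn fun u hu =>
    hinj u (congrArg Prod.fst hu) (congrArg Prod.snd hu)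
  refine ⟨_, inter_mem ((continuousAt_extChartAt (I := phaseModel) z).preimage_mem_nhds hN)
    (extChartAt_source_mem_nhds (I := phaseModel) z), ?_⟩
  rintro w ⟨hw, hws⟩ w' ⟨hw', hws'⟩ h2 h3
  refine (extChartAt phaseModel z).injOn hws hws' (hi hw hw' ?_)
  simp only [Function.comp_apply, (extChartAt phaseModel z).left_inv hws,
    (extChartAt phaseModel z).left_inv hws', h2, h3]

/-- The coordinate of the base point, in the chart of `X` at the base point of `z`. -/
def position (z w : CotangentBundle X) : Plane := extChartAt (𝓡 2) z.proj w.proj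

theorem contMDiffAt_position (z : CotangentBundle X) :
    ContMDiffAt phaseModel (𝓡 2) ∞ (position z) z :=
  (contMDiffAt_extChartAt (I := 𝓡 2) (n := ∞) (x := z.proj)).comp z
    (contMDiff_proj (CotangentSpace X)).contMDiffAt

theorem mfderiv_position (z : CotangentBundle X) (u : Phase) :
    mfderiv phaseModel (𝓡 2) (position z) z u = u.1 := by
  rw [mfderiv_eq_fderiv ((contMDiffAt_position z).mdifferentiableAt (by simp))]
  have h : position z ∘ (extChartAt phaseModel z).symm =ᶠ[𝓝 (extChartAt phaseModel z z)]
      Prod.fst := by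
    filter_upwards [(isOpen_extChartAt_target z).mem_nhds (mem_extChartAt_target z)] with y hy
    have := (extChartAt phaseModel z).right_inv hy
    rw [extChartAt_cotangent] at this
    exact congrArg Prod.fst this
  rw [h.fderiv_eq]
  rw [fderiv_fst]
  rfl

theorem diffProj_apply (z : CotangentBundle X) (u : Phase) : diffProj z u = u.1 := by
  rw [← mfderiv_position z u]
  have h : MDifferentiableAt phaseModel (𝓡 2) (fun w : CotangentBundle X => w.proj) z :=
    ((contMDiff_proj (n := ∞) (CotangentSpace X)).contMDiffAt).mdifferentiableAt (by simp)
  rw [diffProj, h.mfderiv, ((contMDiffAt_position z).mdifferentiableAt (by simp)).mfderiv]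
  rfl

/-! ### The symplectic form and its invariance under changes of charts -/

/-- The canonical symplectic form of the model phase space. -/
def symplecticForm (u v : Phase) : ℝ := u.2 v.1 - v.2 u.1

theorem eq_of_symplecticForm_eq {u u' : Phase}
    (h : ∀ v, symplecticForm v u = symplecticForm v u') : u = u' := by
  have h1 (b : Plane →L[ℝ] ℝ) : b (u.1 - u'.1) = 0 := by
    have := h (0, b)
    simp [symplecticForm] at this
    simp [this]
  refine Prod.ext (sub_eq_zero.1 ?_) (ContinuousLinearMap.ext fun a => ?_)
  · ext i
    exact h1 (EuclideanSpace.proj i)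
  · simpa [symplecticForm] using h (a, 0)

set_option synthInstance.maxHeartbeats 200000 in
/-- The symplectic gradient of a linear form on the model phase space, as a linear map. -/
def symplecticGradientₗ : (Phase →L[ℝ] ℝ) →ₗ[ℝ] Phase where
  toFun l := (WithLp.toLp 2 fun i => l (0, EuclideanSpace.proj i),
    -(l ∘L ContinuousLinearMap.inl ℝ Plane (Plane →L[ℝ] ℝ)))
  map_add' l l' := by
    refine Prod.ext ?_ ?_
    · ext i; simp
    · refine ContinuousLinearMap.ext fun a => ?_
      simp; ring
  map_smul' r l := by
    refine Prod.ext ?_ ?_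
    · ext i; simp
    · refine ContinuousLinearMap.ext fun a => ?_
      simp

/-- The symplectic gradient of a linear form on the model phase space. -/
def symplecticGradient : (Phase →L[ℝ] ℝ) →L[ℝ] Phase where
  toLinearMap := symplecticGradientₗ
  cont := by
    change Continuous fun l : Phase →L[ℝ] ℝ =>
      ((WithLp.toLp 2 fun i => l (0, EuclideanSpace.proj i),
        -(l ∘L ContinuousLinearMap.inl ℝ Plane (Plane →L[ℝ] ℝ))) : Phase)
    refine Continuous.prodMk ?_ ?_
    · refine (PiLp.continuous_toLp 2 _).comp (continuous_pi fun i => ?_)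
      exact (ContinuousLinearMap.apply ℝ ℝ _).continuous
    · exact (continuous_id.clm_comp continuous_const).neg

set_option synthInstance.maxHeartbeats 200000 in
theorem symplecticForm_symplecticGradient (l : Phase →L[ℝ] ℝ) (v : Phase) :
    symplecticForm v (symplecticGradient l) = l v := by
  obtain ⟨a, b⟩ := v
  have hb : b = ∑ i : Fin 2, b (EuclideanSpace.single i 1) • EuclideanSpace.proj i := by
    ext a
    conv_lhs => rw [← (EuclideanSpace.basisFun (Fin 2) ℝ).sum_repr a]
    simp [mul_comm]
  have h1 : l (0, b) = ∑ i : Fin 2, b (EuclideanSpace.single i 1) * l (0, EuclideanSpace.proj i) := by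
    have : ((0 : Plane), b) = ∑ i : Fin 2, b (EuclideanSpace.single i 1) •
        ((0 : Plane), (EuclideanSpace.proj i : Plane →L[ℝ] ℝ)) := by
      conv_lhs => rw [hb]
      simp
    rw [this, map_sum]
    exact Finset.sum_congr rfl fun i _ => by rw [map_smul, smul_eq_mul]
  have h2 (c : Plane) : b c = ∑ i : Fin 2, b (EuclideanSpace.single i 1) * c i := by
    conv_lhs => rw [hb]
    simp
  have h3 : l (a, b) = l (a, 0) + l (0, b) := by rw [← map_add]; simp
  rw [h3, h1]
  have h4 : symplecticGradient l = ((WithLp.toLp 2 fun i => l (0, EuclideanSpace.proj i),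
    -(l ∘L ContinuousLinearMap.inl ℝ Plane (Plane →L[ℝ] ℝ))) : Phase) := rfl
  rw [symplecticForm, h4, h2]
  simp
  ring

theorem eq_symplecticGradient {l : Phase →L[ℝ] ℝ} {u : Phase}
    (h : ∀ v, symplecticForm v u = l v) : u = symplecticGradient l :=
  eq_of_symplecticForm_eq fun v => (h v).trans (symplecticForm_symplecticGradient l v).symm

/-- Differentiating the momentum component produces `p ∘ dη` and a term in `D²η`. The latter cancels
in the antisymmetric form because second derivatives are symmetric; the former is handled by `dη ∘
dκ = id`. -/
theorem symplecticForm_fderiv_cotangentLift {κ η : Plane → Plane} {y : Phase}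
    (hκ : DifferentiableAt ℝ κ y.1) (hη : ContDiffAt ℝ ∞ η (κ y.1))
    (hinv : ∀ᶠ q in 𝓝 y.1, η (κ q) = q) (u v : Phase) :
    symplecticForm (fderiv ℝ (fun y : Phase => ((κ y.1, y.2 ∘L fderiv ℝ η (κ y.1)) : Phase)) y u)
      (fderiv ℝ (fun y : Phase => ((κ y.1, y.2 ∘L fderiv ℝ η (κ y.1)) : Phase)) y v) =
      symplecticForm u v := by
  have hη1 : DifferentiableAt ℝ η (κ y.1) := hη.differentiableAt (by simp)
  have hη2 : DifferentiableAt ℝ (fderiv ℝ η) (κ y.1) :=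
    (hη.fderiv_right (m := 1) (by norm_cast)).differentiableAt (by simp)
  have hsymm : IsSymmSndFDerivAt ℝ η (κ y.1) := hη.isSymmSndFDerivAt (by simp; norm_cast)
  have hid (a : Plane) : fderiv ℝ η (κ y.1) (fderiv ℝ κ y.1 a) = a := by
    have h1 := hη1.hasFDerivAt.comp y.1 hκ.hasFDerivAt
    have h2 := h1.unique ((hasFDerivAt_id y.1).congr_of_eventuallyEq hinv)
    exact congrArg (fun k : Plane →L[ℝ] Plane => k a) h2
  have hfst : HasFDerivAt (fun y : Phase => κ y.1)
      (fderiv ℝ κ y.1 ∘L ContinuousLinearMap.fst ℝ Plane (Plane →L[ℝ] ℝ)) y :=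
    hκ.hasFDerivAt.comp y hasFDerivAt_fst
  have hA : HasFDerivAt (fun y : Phase => fderiv ℝ η (κ y.1))
      (fderiv ℝ (fderiv ℝ η) (κ y.1) ∘L fderiv ℝ κ y.1 ∘L
        ContinuousLinearMap.fst ℝ Plane (Plane →L[ℝ] ℝ)) y := hη2.hasFDerivAt.comp y hfst
  have hsnd := (hasFDerivAt_snd (𝕜 := ℝ) (p := y)).clm_comp hA
  rw [(hfst.prodMk hsnd).fderiv]
  have hs := hsymm (fderiv ℝ κ y.1 u.1) (fderiv ℝ κ y.1 v.1)
  simp [symplecticForm, hid]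
  rw [show _ = _ from hs]
  ring

theorem continuousLinearMapAt_comp_symmL_eq_fderiv {x₀ x₁ x : X}
    (h₀ : x ∈ (chartAt Plane x₀).source) (h₁ : x ∈ (chartAt Plane x₁).source) (a : Plane) :
    (trivializationAt Plane (TangentSpace (𝓡 2)) x₁).continuousLinearMapAt ℝ x
      ((trivializationAt Plane (TangentSpace (𝓡 2)) x₀).symmL ℝ x a) =
      fderiv ℝ (extChartAt (𝓡 2) x₁ ∘ (extChartAt (𝓡 2) x₀).symm) (extChartAt (𝓡 2) x₀ x) a := by
  rw [TangentBundle.continuousLinearMapAt_trivializationAt_eq_core h₁,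
    TangentBundle.symmL_trivializationAt_eq_core h₀]
  have h := tangentCoordChange_comp (I := 𝓡 2) (w := x₀) (x := x) (y := x₁) (z := x) (v := a)
    ⟨⟨by simpa using h₀, mem_extChartAt_source x⟩, by simpa using h₁⟩
  refine h.trans ?_
  rw [tangentCoordChange_def, ModelWithCorners.range_eq_univ, fderivWithin_univ]

/-- Covectors transform by the inverse differential of the coordinate change, so transitions of
`T*X` are cotangent lifts, hence symplectic. -/
theorem extChartAt_transition_eventuallyEq {z w : CotangentBundle X}
    (hw : w ∈ (extChartAt phaseModel z).source) :
    extChartAt phaseModel z ∘ (extChartAt phaseModel w).symm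
      =ᶠ[𝓝 (extChartAt phaseModel w w)] fun y : Phase =>
        (((extChartAt (𝓡 2) z.proj ∘ (extChartAt (𝓡 2) w.proj).symm) y.1,
          y.2 ∘L fderiv ℝ (extChartAt (𝓡 2) w.proj ∘ (extChartAt (𝓡 2) z.proj).symm)
            ((extChartAt (𝓡 2) z.proj ∘ (extChartAt (𝓡 2) w.proj).symm) y.1)) : Phase) := by
  have hcont : ContinuousAt (extChartAt phaseModel w).symm (extChartAt phaseModel w w) :=
    continuousAt_extChartAt_symm w
  have hev : ∀ᶠ y in 𝓝 (extChartAt phaseModel w w),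
      (extChartAt phaseModel w).symm y ∈ (extChartAt phaseModel z).source := by
    refine hcont.eventually ((isOpen_extChartAt_source z).mem_nhds ?_)
    rwa [extChartAt_to_inv]
  filter_upwards [(isOpen_extChartAt_target w).mem_nhds (mem_extChartAt_target w), hev]
    with y hy hyz
  obtain ⟨u, hu, rfl⟩ : ∃ u ∈ (extChartAt phaseModel w).source, extChartAt phaseModel w u = y :=
    ⟨_, (extChartAt phaseModel w).map_target hy, (extChartAt phaseModel w).right_inv hy⟩
  rw [(extChartAt phaseModel w).left_inv hu] at hyz
  have huw := (mem_extChartAt_source_iff w u).1 hu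
  have huz := (mem_extChartAt_source_iff z u).1 hyz
  rw [Function.comp_apply, (extChartAt phaseModel w).left_inv hu, extChartAt_cotangent z u,
    extChartAt_cotangent w u]
  simp only [Function.comp_apply, (extChartAt (𝓡 2) w.proj).left_inv huw]
  refine Prod.ext rfl (ContinuousLinearMap.ext fun a => ?_)
  rw [extChartAt_source] at huw huz
  rw [ContinuousLinearMap.comp_apply, ContinuousLinearMap.comp_apply,
    ContinuousLinearMap.comp_apply]
  have h1 := continuousLinearMapAt_comp_symmL_eq_fderiv huz huw a
  have h2 := (trivializationAt Plane (TangentSpace (𝓡 2)) w.proj).symmL_continuousLinearMapAt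
    (R := ℝ) (by simpa using huw) ((trivializationAt Plane (TangentSpace (𝓡 2)) z.proj).symmL ℝ
      u.proj a)
  rw [h1] at h2
  exact congrArg _ h2.symm

theorem contDiffAt_extChartAt_transition {x₀ x₁ x : X} (h₀ : x ∈ (extChartAt (𝓡 2) x₀).source)
    (h₁ : x ∈ (extChartAt (𝓡 2) x₁).source) :
    ContDiffAt ℝ ∞ (extChartAt (𝓡 2) x₁ ∘ (extChartAt (𝓡 2) x₀).symm)
      (extChartAt (𝓡 2) x₀ x) := by
  have := contDiffWithinAt_ext_coord_change (I := 𝓡 2) (n := ∞) x₁ x₀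
    (y := extChartAt (𝓡 2) x₀ x) (by
      rw [PartialEquiv.trans_source, PartialEquiv.symm_source]
      exact ⟨(extChartAt (𝓡 2) x₀).map_source h₀, by
        rwa [mem_preimage, (extChartAt (𝓡 2) x₀).left_inv h₀]⟩)
  rwa [ModelWithCorners.range_eq_univ, contDiffWithinAt_univ] at this

theorem symplecticForm_fderiv_transition {z w : CotangentBundle X}
    (hw : w ∈ (extChartAt phaseModel z).source) (u v : Phase) :
    symplecticForm
      (fderiv ℝ (extChartAt phaseModel z ∘ (extChartAt phaseModel w).symm)
        (extChartAt phaseModel w w) u)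
      (fderiv ℝ (extChartAt phaseModel z ∘ (extChartAt phaseModel w).symm)
        (extChartAt phaseModel w w) v) = symplecticForm u v := by
  have hwz := (mem_extChartAt_source_iff z w).1 hw
  have hww := mem_extChartAt_source (I := 𝓡 2) w.proj
  have hfst : (extChartAt phaseModel w w).1 = extChartAt (𝓡 2) w.proj w.proj := by
    rw [extChartAt_cotangent]
  rw [(extChartAt_transition_eventuallyEq hw).fderiv_eq]
  refine symplecticForm_fderiv_cotangentLift ?_ ?_ ?_ u v
  · rw [hfst]
    exact (contDiffAt_extChartAt_transition hww hwz).differentiableAt (by simp)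
  · rw [hfst, Function.comp_apply, extChartAt_to_inv]
    exact contDiffAt_extChartAt_transition hwz hww
  · rw [hfst]
    have hc : ContinuousAt (extChartAt (𝓡 2) w.proj).symm (extChartAt (𝓡 2) w.proj w.proj) :=
      continuousAt_extChartAt_symm w.proj
    have hev : ∀ᶠ q in 𝓝 (extChartAt (𝓡 2) w.proj w.proj),
        (extChartAt (𝓡 2) w.proj).symm q ∈ (extChartAt (𝓡 2) z.proj).source := by
      refine hc.eventually ((isOpen_extChartAt_source z.proj).mem_nhds ?_)
      rwa [extChartAt_to_inv]
    filter_upwards [(isOpen_extChartAt_target w.proj).mem_nhds (mem_extChartAt_target w.proj),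
      hev] with q hq hqz
    simp only [Function.comp_apply, (extChartAt (𝓡 2) z.proj).left_inv hqz,
      (extChartAt (𝓡 2) w.proj).right_inv hq]

theorem differentiableAt_transition {z w : CotangentBundle X}
    (hw : w ∈ (extChartAt phaseModel z).source) :
    DifferentiableAt ℝ (extChartAt phaseModel z ∘ (extChartAt phaseModel w).symm)
      (extChartAt phaseModel w w) := by
  refine (contDiffAt_of_contMDiffAt (mem_extChartAt_source w)
    (contMDiffAt_extChartAt' ?_)).differentiableAt (by simp)
  rwa [extChartAt_source] at hw

/-- `diff f w` is read in the chart at `w`, which moves with `w`. Differentiating it in `w` requires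
transporting it to the fixed chart at `z`. -/
theorem diff_eq_fderiv_comp {f : CotangentBundle X → ℝ} {z w : CotangentBundle X}
    (hw : w ∈ (extChartAt phaseModel z).source) (hf : ContMDiffAt phaseModel 𝓘(ℝ, ℝ) ∞ f w)
    (v : Phase) :
    diff f w v = fderiv ℝ (f ∘ (extChartAt phaseModel z).symm) (extChartAt phaseModel z w)
      (fderiv ℝ (extChartAt phaseModel z ∘ (extChartAt phaseModel w).symm)
        (extChartAt phaseModel w w) v) := by
  have hc : ContinuousAt (extChartAt phaseModel w).symm (extChartAt phaseModel w w) :=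
    continuousAt_extChartAt_symm w
  have hev : f ∘ (extChartAt phaseModel w).symm =ᶠ[𝓝 (extChartAt phaseModel w w)]
      (f ∘ (extChartAt phaseModel z).symm) ∘
        (extChartAt phaseModel z ∘ (extChartAt phaseModel w).symm) := by
    have : ∀ᶠ y in 𝓝 (extChartAt phaseModel w w),
        (extChartAt phaseModel w).symm y ∈ (extChartAt phaseModel z).source := by
      refine hc.eventually ((isOpen_extChartAt_source z).mem_nhds ?_)
      rwa [extChartAt_to_inv]
    filter_upwards [this] with y hy
    simp only [Function.comp_apply, (extChartAt phaseModel z).left_inv hy]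
  have hG : DifferentiableAt ℝ (f ∘ (extChartAt phaseModel z).symm)
      ((extChartAt phaseModel z ∘ (extChartAt phaseModel w).symm) (extChartAt phaseModel w w)) := by
    rw [Function.comp_apply (f := extChartAt phaseModel z), extChartAt_to_inv]
    exact (contDiffAt_of_contMDiffAt hw hf).differentiableAt (by simp)
  rw [diff, mfderiv_eq_fderiv (hf.mdifferentiableAt (by simp)), hev.fderiv_eq,
    fderiv_comp _ hG (differentiableAt_transition hw),
    Function.comp_apply (f := extChartAt phaseModel z), extChartAt_to_inv]
  rfl

/-! ### Hamiltonian fields in a fixed chart and the kernel of the Hessian -/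

theorem symplecticForm_hamiltonianField (H : CotangentBundle X → ℝ) (z : CotangentBundle X)
    (v : Phase) : symplecticForm v (hamiltonianField H z) = diff H z v :=
  symplecticForm_symplecticGradient (diff H z) v

/-- A symplectic transition is injective, hence bijective by dimension, and so intertwines
symplectic gradients. -/
theorem fderiv_transition_hamiltonianField {H : CotangentBundle X → ℝ} {z w : CotangentBundle X}
    (hw : w ∈ (extChartAt phaseModel z).source) (hH : ContMDiffAt phaseModel 𝓘(ℝ, ℝ) ∞ H w) :
    fderiv ℝ (extChartAt phaseModel z ∘ (extChartAt phaseModel w).symm)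
        (extChartAt phaseModel w w) (hamiltonianField H w) =
      symplecticGradient (fderiv ℝ (H ∘ (extChartAt phaseModel z).symm)
        (extChartAt phaseModel z w)) := by
  set T := fderiv ℝ (extChartAt phaseModel z ∘ (extChartAt phaseModel w).symm)
    (extChartAt phaseModel w w) with hT
  have hinj : Function.Injective (T : Phase →ₗ[ℝ] Phase) := by
    intro u u' h
    refine eq_of_symplecticForm_eq fun v => ?_
    rw [← symplecticForm_fderiv_transition hw v u, ← symplecticForm_fderiv_transition hw v u']
    exact congrArg _ h
  refine eq_symplecticGradient fun v => ?_
  obtain ⟨v, rfl⟩ := (LinearMap.injective_iff_surjective.1 hinj) v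
  refine (symplecticForm_fderiv_transition hw v _).trans ?_
  rw [symplecticForm_hamiltonianField, diff_eq_fderiv_comp hw hH]
  rfl

set_option synthInstance.maxHeartbeats 200000 in
-- Differentiate the identity `df(X_H) = 0` at `z` in the direction `v`: the term containing the
-- derivative of `X_H` is killed by `df(z) = 0`, leaving the Hessian term.
theorem hessian_hamiltonianField {f H : CotangentBundle X → ℝ} {z : CotangentBundle X}
    (hf : ∀ᶠ w in 𝓝 z, ContMDiffAt phaseModel 𝓘(ℝ, ℝ) ∞ f w)
    (hH : ∀ᶠ w in 𝓝 z, ContMDiffAt phaseModel 𝓘(ℝ, ℝ) ∞ H w)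
    (hcomm : ∀ᶠ w in 𝓝 z, diff f w (hamiltonianField H w) = 0) (hz : diff f z = 0) (v : Phase) :
    hessian f z (hamiltonianField H z) v = 0 := by
  have hfz := contDiffAt_of_contMDiffAt (mem_extChartAt_source z) hf.self_of_nhds
  have hHz := contDiffAt_of_contMDiffAt (mem_extChartAt_source z) hH.self_of_nhds
  have hc : ContinuousAt (extChartAt phaseModel z).symm (extChartAt phaseModel z z) :=
    continuousAt_extChartAt_symm z
  have hc' : Tendsto (extChartAt phaseModel z).symm (𝓝 (extChartAt phaseModel z z)) (𝓝 z) := by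
    simpa only [ContinuousAt, extChartAt_to_inv] using hc
  have hzero : (fun y => fderiv ℝ (f ∘ (extChartAt phaseModel z).symm) y
      (symplecticGradient (fderiv ℝ (H ∘ (extChartAt phaseModel z).symm) y)))
      =ᶠ[𝓝 (extChartAt phaseModel z z)] fun _ => (0 : ℝ) := by
    filter_upwards [hc'.eventually hf, hc'.eventually hH, hc'.eventually hcomm,
      (isOpen_extChartAt_target z).mem_nhds (mem_extChartAt_target z)] with y h1 h2 h3 hy
    have hs := (extChartAt phaseModel z).map_target hy
    have h4 := (diff_eq_fderiv_comp hs h1 _).symm.trans h3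
    rw [fderiv_transition_hamiltonianField hs h2, (extChartAt phaseModel z).right_inv hy] at h4
    exact h4
  have hdf : diff f z = fderiv ℝ (f ∘ (extChartAt phaseModel z).symm)
      (extChartAt phaseModel z z) :=
    mfderiv_eq_fderiv (hf.self_of_nhds.mdifferentiableAt (by simp))
  have hdH : diff H z = fderiv ℝ (H ∘ (extChartAt phaseModel z).symm)
      (extChartAt phaseModel z z) :=
    mfderiv_eq_fderiv (hH.self_of_nhds.mdifferentiableAt (by simp))
  have h1 := ((hfz.fderiv_right (m := 1) (by norm_cast)).differentiableAt (by simp)).hasFDerivAt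
  have h2 := ((hHz.fderiv_right (m := 1) (by norm_cast)).differentiableAt (by simp)).hasFDerivAt
  have h3 := h1.clm_apply (symplecticGradient.hasFDerivAt.comp _ h2)
  have h4 := congrArg (fun k => k v)
    (h3.unique ((hasFDerivAt_const (0 : ℝ) _).congr_of_eventuallyEq hzero))
  have hsymm : IsSymmSndFDerivAt ℝ (f ∘ (extChartAt phaseModel z).symm)
      (extChartAt phaseModel z z) := hfz.isSymmSndFDerivAt (by simp; norm_cast)
  have h5 := hsymm (hamiltonianField H z) v
  rw [hessian]
  refine h5.trans ?_
  rw [← hdf, hz] at h4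
  have h6 : (hamiltonianField H z : Phase) = symplecticGradient (fderiv ℝ
    (H ∘ (extChartAt phaseModel z).symm) (extChartAt phaseModel z z)) := by rw [← hdH]; rfl
  rw [h6]
  simpa using h4

/-! ### Linear algebra of transversality -/

section LinearAlgebra

theorem finrank_phase : Module.finrank ℝ Phase = 4 := by
  have h : Module.finrank ℝ (Plane →L[ℝ] ℝ) = 2 := by
    rw [← (LinearMap.toContinuousLinearMap (𝕜 := ℝ) (E := Plane) (F' := ℝ)).finrank_eq]
    exact (Subspace.dual_finrank_eq (K := ℝ) (V := Plane)).trans (by simp)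
  rw [Module.finrank_prod, h]
  simp

theorem exists_eq_smul_of_surjective {L : Phase →L[ℝ] EuclideanSpace ℝ (Fin 3)}
    (hL : Function.Surjective L) {x u : Phase} (hx : x ≠ 0) (hLx : L x = 0) (hLu : L u = 0) :
    ∃ c : ℝ, u = c • x := by
  have h := LinearMap.finrank_range_add_finrank_ker (L : Phase →ₗ[ℝ] EuclideanSpace ℝ (Fin 3))
  rw [LinearMap.range_eq_top.2 hL, finrank_top, finrank_phase] at h
  have h1 : Module.finrank ℝ (LinearMap.ker (L : Phase →ₗ[ℝ] EuclideanSpace ℝ (Fin 3))) = 1 := by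
    simp only [finrank_euclideanSpace, Fintype.card_fin] at h
    omega
  obtain ⟨c, hc⟩ := (finrank_eq_one_iff_of_nonzero'
    (⟨x, hLx⟩ : LinearMap.ker (L : Phase →ₗ[ℝ] EuclideanSpace ℝ (Fin 3)))
    (fun h => hx (congrArg Subtype.val h))).1 h1 ⟨u, hLu⟩
  exact ⟨c, (congrArg Subtype.val hc).symm⟩

/-- The map `(L, P)` is onto a space of the same dimension, hence injective. -/
theorem eq_zero_of_surjective_on_ker {U V W : Type*} [AddCommGroup U] [Module ℝ U]
    [FiniteDimensional ℝ U] [AddCommGroup V] [Module ℝ V] [FiniteDimensional ℝ V]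
    [AddCommGroup W] [Module ℝ W] [FiniteDimensional ℝ W] (L : V →ₗ[ℝ] W) (P : V →ₗ[ℝ] U)
    (hL : Function.Surjective L) (hP : ∀ a, ∃ v, L v = 0 ∧ P v = a)
    (hdim : Module.finrank ℝ V = Module.finrank ℝ W + Module.finrank ℝ U) {u : V}
    (hLu : L u = 0) (hPu : P u = 0) : u = 0 := by
  have hsurj : Function.Surjective (L.prod P) := by
    rintro ⟨x, a⟩
    obtain ⟨v₀, rfl⟩ := hL x
    obtain ⟨v₁, h1, h2⟩ := hP (a - P v₀)
    exact ⟨v₀ + v₁, by simp [h1, h2]⟩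
  have hinj := (LinearMap.injective_iff_surjective_of_finrank_eq_finrank
    (by rw [hdim, Module.finrank_prod])).2 hsurj
  exact hinj (by simp [hLu, hPu])

/-- A plane in phase space that projects onto the base is transverse to the fibre. -/
theorem eq_zero_of_fst_eq_zero {k l : Phase →L[ℝ] ℝ}
    (hind : ∀ r s : ℝ, (r, s) ≠ (0, 0) → r • k + s • l ≠ 0)
    (hproj : ∀ a : Plane, ∃ v : Phase, k v = 0 ∧ l v = 0 ∧ v.1 = a)
    {u : Phase} (hk : k u = 0) (hl : l u = 0) (hu : u.1 = 0) : u = 0 := by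
  let L : Phase →ₗ[ℝ] ℝ × ℝ := (k : Phase →ₗ[ℝ] ℝ).prod (l : Phase →ₗ[ℝ] ℝ)
  have hL : LinearMap.range L = ⊤ := by
    -- A proper range would lie in the kernel of a nonzero form on `ℝ²`, whose coefficients give a
    -- linear relation between `k` and `l`.
    by_contra hne
    obtain ⟨f, hf, hle⟩ := Submodule.exists_le_ker_of_lt_top _ (lt_top_iff_ne_top.2 hne)
    have hf' (x : ℝ × ℝ) : f x = f (1, 0) * x.1 + f (0, 1) * x.2 := by
      have : x = x.1 • ((1, 0) : ℝ × ℝ) + x.2 • ((0, 1) : ℝ × ℝ) := by ext <;> simp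
      conv_lhs => rw [this]
      rw [map_add, map_smul, map_smul, smul_eq_mul, smul_eq_mul]
      ring
    refine hind (f (1, 0)) (f (0, 1)) (fun h => hf (LinearMap.ext fun x => ?_))
      (ContinuousLinearMap.ext fun v => ?_)
    · rw [hf', (Prod.mk.inj h).1, (Prod.mk.inj h).2]; simp
    · have : f (L v) = 0 := hle ⟨v, rfl⟩
      rw [hf'] at this
      exact this
  refine eq_zero_of_surjective_on_ker L (LinearMap.fst ℝ Plane (Plane →L[ℝ] ℝ))
    (LinearMap.range_eq_top.1 hL) (fun a => ?_) (by rw [finrank_phase]; simp) (Prod.ext hk hl) hu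
  obtain ⟨v, h1, h2, h3⟩ := hproj a
  exact ⟨v, Prod.ext h1 h2, h3⟩

end LinearAlgebra

/-! ### Poisson commutation and conserved quantities -/

theorem diff_hamiltonianField_antisymm (f g : CotangentBundle X → ℝ) (z : CotangentBundle X) :
    diff f z (hamiltonianField g z) = -diff g z (hamiltonianField f z) := by
  have h1 := symplecticForm_hamiltonianField f z (hamiltonianField g z)
  have h2 := symplecticForm_hamiltonianField g z (hamiltonianField f z)
  refine h1.symm.trans (Eq.trans ?_ (congrArg Neg.neg h2))
  simp only [symplecticForm]
  ring

theorem hamiltonianField_ne_zero {H : CotangentBundle X → ℝ} {z : CotangentBundle X}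
    (h : diff H z ≠ 0) : (hamiltonianField H z : Phase) ≠ 0 := fun h0 =>
  h (ContinuousLinearMap.ext fun v => by
    refine (symplecticForm_hamiltonianField H z v).symm.trans ?_
    rw [show symplecticForm v (hamiltonianField H z) = symplecticForm v 0 from
      congrArg (symplecticForm v) h0]
    simp [symplecticForm])

theorem diff_add_mul {I J : CotangentBundle X → ℝ} {z : CotangentBundle X}
    (hI : ContMDiffAt phaseModel 𝓘(ℝ, ℝ) ∞ I z) (hJ : ContMDiffAt phaseModel 𝓘(ℝ, ℝ) ∞ J z)
    (l m : ℝ) : ContMDiffAt phaseModel 𝓘(ℝ, ℝ) ∞ (fun w => l * I w + m * J w) z ∧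
      diff (fun w => l * I w + m * J w) z = l • diff I z + m • diff J z := by
  have h : ContMDiffAt phaseModel 𝓘(ℝ, ℝ) ∞ (fun w => l * I w + m * J w) z :=
    (contMDiffAt_const.mul hI).add (contMDiffAt_const.mul hJ)
  refine ⟨h, ?_⟩
  have hI' := (contDiffAt_of_contMDiffAt (mem_extChartAt_source z) hI).differentiableAt (by simp)
  have hJ' := (contDiffAt_of_contMDiffAt (mem_extChartAt_source z) hJ).differentiableAt (by simp)
  rw [diff, diff, diff, mfderiv_eq_fderiv (h.mdifferentiableAt (by simp)),
    mfderiv_eq_fderiv (hI.mdifferentiableAt (by simp)),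
    mfderiv_eq_fderiv (hJ.mdifferentiableAt (by simp))]
  exact ((hI'.hasFDerivAt.const_mul l).add (hJ'.hasFDerivAt.const_mul m)).fderiv

theorem hasDerivAt_comp_curve {f : CotangentBundle X → ℝ} {c : ℝ → CotangentBundle X} {t : ℝ}
    {v : Phase} (hf : ContMDiffAt phaseModel 𝓘(ℝ, ℝ) ∞ f (c t))
    (hc : HasMFDerivAt 𝓘(ℝ, ℝ) phaseModel c t ((1 : ℝ →L[ℝ] ℝ).smulRight v : ℝ →L[ℝ] Phase)) :
    HasDerivAt (fun s => f (c s)) (diff f (c t) v) t := by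
  have h := (hf.mdifferentiableAt (by simp)).hasMFDerivAt.comp t hc
  have h1 : HasFDerivAt (fun s => f (c s))
      (diff f (c t) ∘L ((1 : ℝ →L[ℝ] ℝ).smulRight v : ℝ →L[ℝ] Phase)) t :=
    hasMFDerivAt_iff_hasFDerivAt.1 h
  have h2 := h1.hasDerivAt
  rwa [ContinuousLinearMap.comp_apply, ContinuousLinearMap.smulRight_apply,
    one_apply_eq_self, one_smul] at h2

theorem const_along_integralCurve {f H : CotangentBundle X → ℝ} {c : ℝ → CotangentBundle X}
    (hc : IsMIntegralCurve (I := phaseModel) c (hamiltonianField H))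
    (hf : ∀ t, ContMDiffAt phaseModel 𝓘(ℝ, ℝ) ∞ f (c t))
    (hcomm : ∀ t, diff f (c t) (hamiltonianField H (c t)) = 0) (s t : ℝ) :
    f (c s) = f (c t) := by
  have h (t : ℝ) : HasDerivAt (fun s => f (c s)) 0 t := by
    rw [← hcomm t]
    exact hasDerivAt_comp_curve (hf t) (hc t)
  exact is_const_of_deriv_eq_zero (fun t => (h t).differentiableAt) (fun t => (h t).deriv) s t

namespace IsIntegrableNear

variable {H I J : CotangentBundle X → ℝ} {E b : ℝ} {z : CotangentBundle X}

theorem mem_of_shell (h : IsIntegrableNear H I J E b) (hz : H z = E) :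
    z ∈ H ⁻¹' Ioo (E - b) (E + b) := by
  have := h.pos
  constructor <;> linarith

theorem contMDiffAt_left (h : IsIntegrableNear H I J E b) (hH : Continuous H)
    (hz : z ∈ H ⁻¹' Ioo (E - b) (E + b)) : ContMDiffAt phaseModel 𝓘(ℝ, ℝ) ∞ I z :=
  h.smooth_left.contMDiffAt ((isOpen_Ioo.preimage hH).mem_nhds hz)

theorem contMDiffAt_right (h : IsIntegrableNear H I J E b) (hH : Continuous H)
    (hz : z ∈ H ⁻¹' Ioo (E - b) (E + b)) : ContMDiffAt phaseModel 𝓘(ℝ, ℝ) ∞ J z :=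
  h.smooth_right.contMDiffAt ((isOpen_Ioo.preimage hH).mem_nhds hz)

theorem exists_diff_eq (h : IsIntegrableNear H I J E b)
    (hH : ContMDiff phaseModel 𝓘(ℝ, ℝ) ∞ H) (hz : z ∈ H ⁻¹' Ioo (E - b) (E + b)) :
    ∃ r s : ℝ, diff H z = r • diff I z + s • diff J z := by
  obtain ⟨Φ, hΦ, hfac⟩ := h.factor
  have hI := h.contMDiffAt_left hH.continuous hz
  have hJ := h.contMDiffAt_right hH.continuous hz
  set φ := extChartAt phaseModel z with hφ
  have hI' := (contDiffAt_of_contMDiffAt (mem_extChartAt_source z) hI).differentiableAt (by simp)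
  have hJ' := (contDiffAt_of_contMDiffAt (mem_extChartAt_source z) hJ).differentiableAt (by simp)
  have hΦ' := ((hΦ (I z, J z) ⟨z, hz, rfl⟩).differentiableWithinAt (by simp)).hasFDerivWithinAt
  set Φ' := fderivWithin ℝ Φ ((fun z => (I z, J z)) '' (H ⁻¹' Ioo (E - b) (E + b))) (I z, J z)
  have hc : ContinuousAt φ.symm (φ z) := continuousAt_extChartAt_symm z
  have hev : ∀ᶠ y in 𝓝 (φ z), φ.symm y ∈ H ⁻¹' Ioo (E - b) (E + b) := by
    refine hc.eventually ((isOpen_Ioo.preimage hH.continuous).mem_nhds ?_)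
    rwa [extChartAt_to_inv]
  have hM := (hI'.hasFDerivAt.prodMk hJ'.hasFDerivAt).hasFDerivWithinAt
    (s := φ.symm ⁻¹' (H ⁻¹' Ioo (E - b) (E + b)))
  -- The image of `M` need not be open, so `Φ` is only differentiated within it. The chain rule is
  -- taken within the preimage of `W`, a neighbourhood of `φ z`, and thus yields a full derivative.
  have hcomp := HasFDerivWithinAt.comp (φ z) (g := Φ) (g' := Φ')
    (t := (fun z => (I z, J z)) '' (H ⁻¹' Ioo (E - b) (E + b))) (by
      simp only [Function.comp_apply, hφ, extChartAt_to_inv]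
      exact hΦ') hM fun y hy => ⟨φ.symm y, hy, rfl⟩
  have hder := (hcomp.hasFDerivAt hev).congr_of_eventuallyEq (f₁ := H ∘ φ.symm)
    (by filter_upwards [hev] with y hy using hfac _ hy)
  refine ⟨Φ' (1, 0), Φ' (0, 1), ?_⟩
  rw [diff, diff, diff, mfderiv_eq_fderiv ((hH z).mdifferentiableAt (by simp)),
    mfderiv_eq_fderiv (hI.mdifferentiableAt (by simp)),
    mfderiv_eq_fderiv (hJ.mdifferentiableAt (by simp)), hder.fderiv]
  refine ContinuousLinearMap.ext fun v => ?_
  have hlin (x y : ℝ) : Φ' (x, y) = Φ' (1, 0) * x + Φ' (0, 1) * y := by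
    have : (x, y) = x • ((1, 0) : ℝ × ℝ) + y • ((0, 1) : ℝ × ℝ) := by ext <;> simp
    rw [this, map_add, map_smul, map_smul, smul_eq_mul, smul_eq_mul]
    ring
  exact hlin _ _

/-- By antisymmetry, it suffices to apply `dH = r dI + s dJ` to the Hamiltonian field of `I`. -/
theorem diff_left_hamiltonianField (h : IsIntegrableNear H I J E b)
    (hH : ContMDiff phaseModel 𝓘(ℝ, ℝ) ∞ H) (hz : z ∈ H ⁻¹' Ioo (E - b) (E + b)) :
    diff I z (hamiltonianField H z) = 0 := by
  obtain ⟨r, s, hrs⟩ := h.exists_diff_eq hH hz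
  have h1 : diff J z (hamiltonianField I z) = 0 := h.commute z hz
  have h2 : diff I z (hamiltonianField I z) = 0 :=
    self_eq_neg.1 (diff_hamiltonianField_antisymm I I z)
  rw [diff_hamiltonianField_antisymm, hrs]
  refine neg_eq_zero.2 ((congrArg₂ (fun x y => r * x + s * y) h2 h1).trans ?_)
  simp

theorem diff_right_hamiltonianField (h : IsIntegrableNear H I J E b)
    (hH : ContMDiff phaseModel 𝓘(ℝ, ℝ) ∞ H) (hz : z ∈ H ⁻¹' Ioo (E - b) (E + b)) :
    diff J z (hamiltonianField H z) = 0 := by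
  obtain ⟨r, s, hrs⟩ := h.exists_diff_eq hH hz
  have h1 : diff I z (hamiltonianField J z) = 0 := by
    rw [diff_hamiltonianField_antisymm]
    exact neg_eq_zero.2 (h.commute z hz)
  have h2 : diff J z (hamiltonianField J z) = 0 :=
    self_eq_neg.1 (diff_hamiltonianField_antisymm J J z)
  rw [diff_hamiltonianField_antisymm, hrs]
  refine neg_eq_zero.2 ((congrArg₂ (fun x y => r * x + s * y) h1 h2).trans ?_)
  simp

end IsIntegrableNear

/-! ### The singular set and the fibre -/

variable {H I J : CotangentBundle X → ℝ} {E b : ℝ} {z : CotangentBundle X}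

/-- If `(r, s)` and `(l, m)` were proportional, `dH` would vanish. So the two equations on `(dI v,
dJ v)` have nonzero determinant `r * m - s * l`. -/
theorem eq_zero_of_momentCritical {dH dI dJ : Phase →L[ℝ] ℝ} {r s l m : ℝ} (hH : dH ≠ 0)
    (hrs : dH = r • dI + s • dJ) (hlm : (l, m) ≠ (0, 0)) (hdep : l • dI + m • dJ = 0)
    {v : Phase} (hv : dH v = 0) : dI v = 0 ∧ dJ v = 0 := by
  have h1 : r * dI v + s * dJ v = 0 := by rw [hrs] at hv; exact hv
  have h2 (w : Phase) : l * dI w + m * dJ w = 0 := congrArg (fun k => k w) hdep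
  have hdet : r * m - s * l ≠ 0 := by
    intro h0
    refine hH (ContinuousLinearMap.ext fun w => ?_)
    have h3 : dH w = r * dI w + s * dJ w := by rw [hrs]; rfl
    rw [h3, zero_apply]
    by_cases hl : l = 0
    · have hm : m ≠ 0 := fun hm => hlm (by rw [hl, hm])
      refine (mul_eq_zero.1 (?_ : m * (r * dI w + s * dJ w) = 0)).resolve_left hm
      linear_combination dI w * h0 + s * h2 w
    · refine (mul_eq_zero.1 (?_ : l * (r * dI w + s * dJ w) = 0)).resolve_left hl
      linear_combination -dJ w * h0 + r * h2 w
  constructor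
  · refine (mul_eq_zero.1 (?_ : (r * m - s * l) * dI v = 0)).resolve_left hdet
    linear_combination m * h1 - s * h2 v
  · refine (mul_eq_zero.1 (?_ : (r * m - s * l) * dJ v = 0)).resolve_left hdet
    linear_combination r * h2 v - l * h1

/-- Near a point of `Z₀`, the set `Z₀` is contained in a curve tangent to the Hamiltonian
vector field. -/
theorem exists_submersion_of_mem_singularSet (h : IsIntegrableNear H I J E b)
    (hH : ContMDiff phaseModel 𝓘(ℝ, ℝ) ∞ H) (hreg : ∀ z ∈ shell H E, diff H z ≠ 0)
    (hMB : MorseBott H I J E) (hz : z ∈ singularSet H I J E) :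
    ∃ F : CotangentBundle X → EuclideanSpace ℝ (Fin 3),
      ContMDiffAt phaseModel (𝓡 3) ∞ F z ∧
      (∀ᶠ w in 𝓝 z, w ∈ singularSet H I J E → F w = 0) ∧
      ∀ u : Phase, mfderiv phaseModel (𝓡 3) F z u = 0 →
        ∃ c : ℝ, u = c • (hamiltonianField H z : Phase) := by
  obtain ⟨hzE, l, m, hlm, hdep⟩ := hz
  obtain ⟨U, F, hU, hzU, hF, hsurj, hcrit, hker⟩ := hMB z hzE l m hlm hdep
  have hopen : IsOpen (H ⁻¹' Ioo (E - b) (E + b)) := isOpen_Ioo.preimage hH.continuous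
  have hev := hopen.mem_nhds (h.mem_of_shell hzE)
  have hlin {w : CotangentBundle X} (hw : w ∈ H ⁻¹' Ioo (E - b) (E + b)) :=
    diff_add_mul (h.contMDiffAt_left hH.continuous hw) (h.contMDiffAt_right hH.continuous hw) l m
  -- The relation `(l', m')` at `w` may differ from `(l, m)`. This is harmless: at `w` both `dI` and
  -- `dJ` vanish on `ker dH`.
  have hsub : ∀ w ∈ singularSet H I J E, w ∈ shellCritical H E fun w => l * I w + m * J w := by
    rintro w ⟨hw, l', m', hlm', hdep'⟩
    refine ⟨hw, fun v hv => ?_⟩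
    obtain ⟨r, s, hrs⟩ := h.exists_diff_eq hH (h.mem_of_shell hw)
    obtain ⟨h1, h2⟩ := eq_zero_of_momentCritical (hreg w hw) hrs hlm' hdep' hv
    rw [(hlin (h.mem_of_shell hw)).2]
    change l * diff I w v + m * diff J w v = 0
    rw [h1, h2]
    simp
  refine ⟨F, hF.contMDiffAt (hU.mem_nhds hzU), ?_, fun u hu => ?_⟩
  · filter_upwards [hU.mem_nhds hzU] with w hw hws using (hcrit w hw).1 (hsub w hws)
  -- The kernel of `dF` is a line, so it is enough that it contains the nonzero vector `X_H`.
  · refine exists_eq_smul_of_surjective hsurj (hamiltonianField_ne_zero (hreg z hzE)) ?_ hu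
    refine (hker (hamiltonianField H z)).2
      ⟨self_eq_neg.1 (diff_hamiltonianField_antisymm H H z), fun v _ => ?_⟩
    refine hessian_hamiltonianField ?_ (Eventually.of_forall fun w => hH w) ?_ ?_ v
    · filter_upwards [hev] with w hw using (hlin hw).1
    · filter_upwards [hev] with w hw
      rw [(hlin hw).2]
      refine (congrArg₂ (fun x y => l * x + m * y) (h.diff_left_hamiltonianField hH hw)
        (h.diff_right_hamiltonianField hH hw)).trans ?_
      simp
    · rw [(hlin (h.mem_of_shell hzE)).2, hdep]

theorem isolated_singular_of_not_vertical (h : IsIntegrableNear H I J E b)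
    (hH : ContMDiff phaseModel 𝓘(ℝ, ℝ) ∞ H) (hreg : ∀ z ∈ shell H E, diff H z ≠ 0)
    (hMB : MorseBott H I J E) (hz : z ∈ singularSet H I J E)
    (hfib : ∃ v, diffProj z v = 0 ∧ diff H z v ≠ 0) :
    ∃ N ∈ 𝓝 z, ∀ w ∈ N, w ∈ singularSet H I J E → w.proj = z.proj → w = z := by
  obtain ⟨F, hF, hF0, hker⟩ := exists_submersion_of_mem_singularSet h hH hreg hMB hz
  obtain ⟨N, hN, hinj⟩ := exists_nhds_injective hF (contMDiffAt_position z) fun u hu hu' => by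
    rw [mfderiv_position] at hu'
    obtain ⟨c, rfl⟩ := hker u hu
    obtain ⟨v, hv, hv'⟩ := hfib
    rw [diffProj_apply] at hv
    -- For a vertical `v`, `dH(v)` is the pairing of `v.2` with the base component of `X_H`, which
    -- therefore is nonzero.
    have hv'' : v.2 (hamiltonianField H z : Phase).1 ≠ 0 := by
      intro h0
      refine hv' ((symplecticForm_hamiltonianField H z v).symm.trans ?_)
      simp only [symplecticForm]
      rw [hv, map_zero, sub_zero]
      exact h0
    have hc : c = 0 := by
      by_contra hc
      refine hv'' ?_
      have h0 : (hamiltonianField H z : Phase).1 = (0 : Plane) :=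
        (smul_eq_zero.1 (hu' : c • (hamiltonianField H z : Phase).1 = (0 : Plane))).resolve_left hc
      exact (congrArg v.2 h0).trans (map_zero v.2)
    rw [hc]
    exact zero_smul ℝ (hamiltonianField H z : Phase)
  refine ⟨_, inter_mem hN hF0, fun w hw hws hproj => ?_⟩
  refine hinj w hw.1 z (mem_of_mem_nhds hN) ?_ (by rw [position, position, hproj])
  rw [hw.2 hws, hF0.self_of_nhds hz]

/-! ### Hyperbolic orbits and their moment values -/

/-- Positive slopes place values of `f` on both sides of `f x`; the intermediate value theorem fills
the gap. -/
theorem _root_.HasDerivAt.image_mem_nhds_of_pos {f : ℝ → ℝ} {f' x : ℝ} (hf : HasDerivAt f f' x)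
    (hf' : 0 < f') {S : Set ℝ} (hS : S ∈ 𝓝 x) (hc : ContinuousOn f S) : f '' S ∈ 𝓝 (f x) := by
  have hslope : ∀ᶠ y in 𝓝[≠] x, 0 < slope f x y := hf.tendsto_slope.eventually_const_lt hf'
  obtain ⟨ε, hε, hball⟩ := Metric.mem_nhds_iff.1 
    (inter_mem hS (eventually_nhdsWithin_iff.1 hslope))
  rw [Real.ball_eq_Ioo] at hball
  have hsub : Icc (x - ε / 2) (x + ε / 2) ⊆ Ioo (x - ε) (x + ε) := fun y hy =>
    ⟨by linarith [hy.1], by linarith [hy.2]⟩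
  have hl := (hball (hsub (left_mem_Icc.2 (by linarith)))).2 (by simp [hε.ne'])
  have hr := (hball (hsub (right_mem_Icc.2 (by linarith)))).2 (by simp [hε.ne'])
  rw [slope_def_field] at hl hr
  have hl' : f (x - ε / 2) < f x := by
    have := mul_neg_of_pos_of_neg hl (by linarith : x - ε / 2 - x < 0)
    rw [div_mul_cancel₀ _ (by linarith)] at this
    linarith
  have hr' : f x < f (x + ε / 2) := by
    have := mul_pos hr (by linarith : 0 < x + ε / 2 - x)
    rw [div_mul_cancel₀ _ (by linarith)] at this
    linarith
  have hIcc : Icc (x - ε / 2) (x + ε / 2) ⊆ S := fun y hy => (hball (hsub hy)).1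
  exact mem_of_superset (Icc_mem_nhds hl' hr')
    ((intermediate_value_Icc (by linarith) (hc.mono hIcc)).trans (image_mono hIcc))

theorem exists_phase_form_eq_one {x : Phase} (hx : x ≠ 0) :
    ∃ ℓ : Phase →L[ℝ] ℝ, ℓ x = 1 ∧ ∀ r : ℝ, ℓ (r • x) = 0 → r • x = 0 := by
  obtain ⟨ℓ, hℓ⟩ := SeparatingDual.exists_eq_one (R := ℝ) hx
  refine ⟨ℓ, hℓ, fun r hr => ?_⟩
  rw [map_smul, hℓ, smul_eq_mul, mul_one] at hr
  rw [hr, zero_smul]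

/-- A trajectory contained in `Z₀` is open in `Z₀`. -/
theorem eventually_mem_range_of_mem_singularSet (h : IsIntegrableNear H I J E b)
    (hH : ContMDiff phaseModel 𝓘(ℝ, ℝ) ∞ H) (hreg : ∀ z ∈ shell H E, diff H z ≠ 0)
    (hMB : MorseBott H I J E) {c : ℝ → CotangentBundle X}
    (hc : IsMIntegralCurve (I := phaseModel) c (hamiltonianField H))
    (hcs : ∀ t, c t ∈ singularSet H I J E) (t₀ : ℝ) :
    ∀ᶠ w in 𝓝 (c t₀), w ∈ singularSet H I J E → w ∈ range c := by
  obtain ⟨F, hF, hF0, hker⟩ := exists_submersion_of_mem_singularSet h hH hreg hMB (hcs t₀)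
  set z := c t₀
  obtain ⟨ℓ, hℓ, hℓ0⟩ := exists_phase_form_eq_one (hamiltonianField_ne_zero (hreg z (hcs t₀).1))
  -- A coordinate along the curve `F = 0`: `(F, ψ)` is injective near `z`, and `ψ ∘ c` has
  -- derivative 1 at `t₀`.
  let ψ : CotangentBundle X → ℝ := fun w => ℓ (extChartAt phaseModel z w)
  have hψ {w : CotangentBundle X} (hw : w ∈ (extChartAt phaseModel z).source) :
      ContMDiffAt phaseModel 𝓘(ℝ, ℝ) ∞ ψ w := by
    rw [extChartAt_source] at hw
    exact ℓ.contMDiff.contMDiffAt.comp w (contMDiffAt_extChartAt' hw)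
  have hψz := hψ (mem_extChartAt_source z)
  have hdψ (u : Phase) : mfderiv phaseModel 𝓘(ℝ, ℝ) ψ z u = ℓ u := by
    rw [mfderiv_eq_fderiv (hψz.mdifferentiableAt (by simp))]
    have hev : ψ ∘ (extChartAt phaseModel z).symm =ᶠ[𝓝 (extChartAt phaseModel z z)] ℓ := by
      filter_upwards [(isOpen_extChartAt_target z).mem_nhds (mem_extChartAt_target z)] with y hy
      exact congrArg ℓ ((extChartAt phaseModel z).right_inv hy)
    rw [hev.fderiv_eq, ℓ.fderiv]
    rfl
  obtain ⟨N, hN, hinj⟩ := exists_nhds_injective hF hψz fun u hu hu' => by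
    rw [hdψ] at hu'
    obtain ⟨r, rfl⟩ := hker u hu
    exact hℓ0 r hu'
  have hcont : Continuous c := continuous_iff_continuousAt.2 fun t => (hc t).continuousAt
  have hder : HasDerivAt (fun t => ψ (c t)) 1 t₀ := by
    have := hasDerivAt_comp_curve (f := ψ) hψz (hc t₀)
    rwa [show diff ψ (c t₀) (hamiltonianField H (c t₀)) = 1 from (hdψ _).trans hℓ] at this
  have hS : c ⁻¹' ((N ∩ {w | w ∈ singularSet H I J E → F w = 0}) ∩
      (extChartAt phaseModel z).source) ∈ 𝓝 t₀ :=
    hcont.continuousAt (inter_mem (inter_mem hN hF0) (extChartAt_source_mem_nhds z))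
  -- The trajectory realises every value of `ψ` near `ψ z`, so a nearby point of `Z₀` shares `F = 0`
  -- and its value of `ψ` with some `c t`, and equals it.
  have himage := hder.image_mem_nhds_of_pos one_pos hS fun t ht =>
    ((hψ ht.2).continuousAt.comp hcont.continuousAt).continuousWithinAt
  filter_upwards [hN, hF0, hψz.continuousAt himage] with w hwN hwF hwψ hws
  obtain ⟨t, ht, htw⟩ := hwψ
  exact ⟨t, hinj _ ht.1.1 _ hwN (by rw [ht.1.2 (hcs t), hwF hws]) htw⟩

theorem moment_const_along_integralCurve (h : IsIntegrableNear H I J E b)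
    (hH : ContMDiff phaseModel 𝓘(ℝ, ℝ) ∞ H) {c : ℝ → CotangentBundle X}
    (hc : IsMIntegralCurve (I := phaseModel) c (hamiltonianField H))
    (hcE : ∀ t, H (c t) = E) (s t : ℝ) : (I (c s), J (c s)) = (I (c t), J (c t)) :=
  Prod.ext
    (const_along_integralCurve hc
      (fun t => h.contMDiffAt_left hH.continuous (h.mem_of_shell (hcE t)))
      (fun t => h.diff_left_hamiltonianField hH (h.mem_of_shell (hcE t))) s t)
    (const_along_integralCurve hc
      (fun t => h.contMDiffAt_right hH.continuous (h.mem_of_shell (hcE t)))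
      (fun t => h.diff_right_hamiltonianField hH (h.mem_of_shell (hcE t))) s t)

theorem IsHyperbolicOrbit.moment_eq {γ : Set (CotangentBundle X)}
    (hγ : IsHyperbolicOrbit H I J E γ) (h : IsIntegrableNear H I J E b)
    (hH : ContMDiff phaseModel 𝓘(ℝ, ℝ) ∞ H) {w : CotangentBundle X} (hz : z ∈ γ) (hw : w ∈ γ) :
    (I w, J w) = (I z, J z) := by
  obtain ⟨⟨c, T, -, -, hc, rfl⟩, hsing, -⟩ := hγ
  obtain ⟨s, rfl⟩ := hw
  obtain ⟨t, rfl⟩ := hz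
  exact moment_const_along_integralCurve h hH hc (fun t => (hsing ⟨t, rfl⟩).1) s t

theorem IsHyperbolicOrbit.eventually_mem {γ : Set (CotangentBundle X)}
    (hγ : IsHyperbolicOrbit H I J E γ) (h : IsIntegrableNear H I J E b)
    (hH : ContMDiff phaseModel 𝓘(ℝ, ℝ) ∞ H) (hreg : ∀ z ∈ shell H E, diff H z ≠ 0)
    (hMB : MorseBott H I J E) (hz : z ∈ γ) :
    ∀ᶠ w in 𝓝 z, w ∈ singularSet H I J E → w ∈ γ := by
  obtain ⟨⟨c, T, -, -, hc, rfl⟩, hsing, -⟩ := hγ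
  obtain ⟨t, rfl⟩ := hz
  exact eventually_mem_range_of_mem_singularSet h hH hreg hMB hc (fun t => hsing ⟨t, rfl⟩) t

/-- The moment map is constant on each orbit and each orbit is open in `Z₀`, so it is locally
constant on their union. -/
theorem countable_moment_hyperbolicOrbits [SecondCountableTopology X]
    (h : IsIntegrableNear H I J E b)
    (hH : ContMDiff phaseModel 𝓘(ℝ, ℝ) ∞ H) (hreg : ∀ z ∈ shell H E, diff H z ≠ 0)
    (hMB : MorseBott H I J E) :
    ((fun z => (I z, J z)) '' ⋃₀ {γ | IsHyperbolicOrbit H I J E γ}).Countable := by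
  have := secondCountableTopology_cotangentBundle (X := X)
  refine countable_image_of_locally_const ?_
  rintro z ⟨γ, hγ, hz⟩
  refine ⟨_, hγ.eventually_mem h hH hreg hMB hz, ?_⟩
  rintro w hw ⟨γ', hγ', hw'⟩
  exact hγ.moment_eq h hH hz (hw (hγ'.2.1 hw'))

theorem tendsto_nhdsSet_of_eq_const {α : Type*} [TopologicalSpace α] {f : α → ℝ} {γ : Set α}
    {k : ℝ} (hf : ∀ z ∈ γ, ContinuousAt f z) (hk : ∀ z ∈ γ, f z = k) :
    Tendsto f (𝓝ˢ γ) (𝓝 k) := fun U hU =>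
  eventually_nhdsSet_iff_forall.2 fun z hz => hf z hz (by rwa [hk z hz])

/-- The moment map is constant on the stable and unstable manifolds of a hyperbolic orbit. -/
theorem IsHyperbolicOrbit.moment_eq_of_tendsto {γ : Set (CotangentBundle X)}
    (hγ : IsHyperbolicOrbit H I J E γ) (h : IsIntegrableNear H I J E b)
    (hH : ContMDiff phaseModel 𝓘(ℝ, ℝ) ∞ H) {c : ℝ → CotangentBundle X}
    (hc : IsMIntegralCurve (I := phaseModel) c (hamiltonianField H)) {l : Filter ℝ} [l.NeBot]
    (hl : Tendsto c l (𝓝ˢ γ)) (hz : z ∈ γ) : (I (c 0), J (c 0)) = (I z, J z) := by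
  have hconst {f : CotangentBundle X → ℝ} (hf : ∀ w ∈ γ, ContinuousAt f w)
      (hfz : ∀ w ∈ γ, f w = f z) (hfc : ∀ t, f (c t) = f (c 0)) : f (c 0) = f z := by
    refine tendsto_nhds_unique ?_ ((tendsto_nhdsSet_of_eq_const hf hfz).comp hl)
    rw [show f ∘ c = fun _ => f (c 0) from funext hfc]
    exact tendsto_const_nhds
  have hγE : ∀ w ∈ γ, H w = E := fun w hw => (hγ.2.1 hw).1
  have hHc (t : ℝ) : H (c t) = H (c 0) := const_along_integralCurve hc (fun t => hH _)
    (fun t => self_eq_neg.1 (diff_hamiltonianField_antisymm H H (c t))) t 0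
  -- `H` comes first: `I` and `J` are known to be smooth and conserved only once the trajectory lies
  -- in `Σ`.
  have hcE (t : ℝ) : H (c t) = E := by
    rw [hHc, hconst (fun w _ => hH.continuous.continuousAt)
      (fun w hw => (hγE w hw).trans (hγE z hz).symm) hHc, hγE z hz]
  have hM := moment_const_along_integralCurve h hH hc hcE
  exact Prod.ext
    (hconst (fun w hw => (h.contMDiffAt_left hH.continuous
        (h.mem_of_shell (hγE w hw))).continuousAt)
      (fun w hw => congrArg Prod.fst (hγ.moment_eq h hH hz hw))
      fun t => congrArg Prod.fst (hM t 0))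
    (hconst (fun w hw => (h.contMDiffAt_right hH.continuous
        (h.mem_of_shell (hγE w hw))).continuousAt)
      (fun w hw => congrArg Prod.snd (hγ.moment_eq h hH hz hw))
      fun t => congrArg Prod.snd (hM t 0))

/-! ### Regular leaves off the caustic -/

/-- Outside the caustic, a Lagrangian leaf is transverse to the fibre. -/
theorem isolated_of_notMem_causticSet (h : IsIntegrableNear H I J E b)
    (hH : ContMDiff phaseModel 𝓘(ℝ, ℝ) ∞ H) (hz : z ∈ shell H E) (hzs : z ∉ singularSet H I J E)
    (hcau : z ∉ causticSet (leaf H I J E z)) :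
    ∃ N ∈ 𝓝 z, ∀ w ∈ N, (I w, J w) = (I z, J z) → w.proj = z.proj → w = z := by
  have hI := h.contMDiffAt_left hH.continuous (h.mem_of_shell hz)
  have hJ := h.contMDiffAt_right hH.continuous (h.mem_of_shell hz)
  have hleaf : z ∈ leaf H I J E z := mem_connectedComponentIn ⟨⟨hz, hzs⟩, rfl, rfl⟩
  have hproj : ∀ u : Plane, ∃ v ∈ tangentVectors (leaf H I J E z) z, diffProj z v = u := by
    by_contra hne
    exact hcau ⟨hleaf, hne⟩
  -- Applied to `I` and `J`, this puts the tangent vectors of the leaf inside `ker dI ∩ ker dJ`.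
  -- This inclusion suffices: the kernel then projects onto the base, so it meets the vertical space
  -- only in zero.
  have hconst {f : CotangentBundle X → ℝ} (hf : ContMDiffAt phaseModel 𝓘(ℝ, ℝ) ∞ f z)
      (hfl : ∀ w ∈ leaf H I J E z, f w = f z) {v : Phase}
      (hv : v ∈ tangentVectors (leaf H I J E z) z) : diff f z v = 0 := by
    obtain ⟨c, hc, hcl, rfl, hcv⟩ := hv
    have hcd := (hc.contMDiffAt (x := 0)).mdifferentiableAt (by simp) |>.hasMFDerivAt
    have hcd' : HasMFDerivAt 𝓘(ℝ, ℝ) phaseModel c 0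
        ((1 : ℝ →L[ℝ] ℝ).smulRight v : ℝ →L[ℝ] Phase) := by
      have : (mfderiv 𝓘(ℝ, ℝ) phaseModel c 0 : ℝ →L[ℝ] Phase) =
          (1 : ℝ →L[ℝ] ℝ).smulRight v := by
        refine ContinuousLinearMap.ext_ring ?_
        exact hcv.trans (one_smul ℝ v).symm
      rw [← this]
      exact hcd
    have h1 := hasDerivAt_comp_curve hf hcd'
    rw [show (fun s => f (c s)) = fun _ => f (c 0) from funext fun s => hfl _ (hcl s)] at h1
    exact h1.unique (hasDerivAt_const _ _)
  have hsub := connectedComponentIn_subset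
    {w | w ∈ shell H E \ singularSet H I J E ∧ I w = I z ∧ J w = J z} z
  have hM : ContMDiffAt phaseModel 𝓘(ℝ, ℝ × ℝ) ∞ (fun w => (I w, J w)) z := hI.prodMk_space hJ
  have hdM (u : Phase) : mfderiv phaseModel 𝓘(ℝ, ℝ × ℝ) (fun w => (I w, J w)) z u =
      (diff I z u, diff J z u) := by
    have hI' := (contDiffAt_of_contMDiffAt (mem_extChartAt_source z) hI).differentiableAt (by simp)
    have hJ' := (contDiffAt_of_contMDiffAt (mem_extChartAt_source z) hJ).differentiableAt (by simp)
    rw [diff, diff, mfderiv_eq_fderiv (hM.mdifferentiableAt (by simp)),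
      mfderiv_eq_fderiv (hI.mdifferentiableAt (by simp)),
      mfderiv_eq_fderiv (hJ.mdifferentiableAt (by simp))]
    exact congrArg (fun k => k u) (hI'.hasFDerivAt.prodMk hJ'.hasFDerivAt).fderiv
  obtain ⟨N, hN, hinj⟩ := exists_nhds_injective hM (contMDiffAt_position z) fun u hu hu' => by
    rw [hdM] at hu
    rw [mfderiv_position] at hu'
    refine eq_zero_of_fst_eq_zero (k := diff I z) (l := diff J z)
      (fun r s hrs h0 => hzs ⟨hz, r, s, hrs, h0⟩) (fun a => ?_) (congrArg Prod.fst hu)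
      (congrArg Prod.snd hu) hu'
    obtain ⟨v, hv, hva⟩ := hproj a
    exact ⟨v, hconst hI (fun w hw => (hsub hw).2.1) hv, hconst hJ (fun w hw => (hsub hw).2.2) hv,
      by rwa [diffProj_apply] at hva⟩
  exact ⟨N, hN, fun w hw hMw hproj => hinj w hw z (mem_of_mem_nhds hN) hMw
    (by rw [position, position, hproj])⟩

end WaveFront

end

/-! ### The countable cover -/

theorem mainTheorem9 {X : Type*} [TopologicalSpace X]
    [ChartedSpace (EuclideanSpace ℝ (Fin 2)) X] [IsManifold (𝓡 2) ∞ X]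
    [T2Space X] [SecondCountableTopology X]
    (H I J : WaveFront.CotangentBundle X → ℝ) (E : ℝ) (A : X)
    (hH : ContMDiff WaveFront.phaseModel 𝓘(ℝ, ℝ) ∞ H)
    (hcompact : ∃ a : ℝ, 0 < a ∧ IsCompact (H ⁻¹' Icc (E - a) (E + a)))
    (hregular : ∀ z ∈ WaveFront.shell H E, WaveFront.diff H z ≠ 0)
    (hfibre : ∀ z ∈ WaveFront.shellAt H E A,
      ∃ v, WaveFront.diffProj z v = 0 ∧ WaveFront.diff H z v ≠ 0)
    (hintegrable : ∃ b : ℝ, WaveFront.IsIntegrableNear H I J E b)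
    (hMorseBott : WaveFront.MorseBott H I J E)
    (hcaustic : {z | z ∈ WaveFront.shellAt H E A ∩
        (WaveFront.separatrixSet H I J E \ WaveFront.singularSet H I J E) ∧
      z ∈ WaveFront.causticSet (WaveFront.leaf H I J E z)}.Finite) :
    WaveFront.CountableSeparatrix H I J E A := by
  obtain ⟨b, h⟩ := hintegrable
  have := WaveFront.secondCountableTopology_cotangentBundle (X := X)
  have hsing : (WaveFront.shellAt H E A ∩ WaveFront.singularSet H I J E).Countable := by
    refine WaveFront.countable_of_isolated fun z hz => ?_
    obtain ⟨N, hN, hiso⟩ := WaveFront.isolated_singular_of_not_vertical h hH hregular hMorseBott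
      hz.2 (hfibre z hz.1)
    exact ⟨N, hN, fun w hw hws => hiso w hw hws.2 (hws.1.2.trans hz.1.2.symm)⟩
  -- The value `k` is fixed because isolation off the caustic holds only within a level set of the
  -- moment map.
  have hlevel (k : ℝ × ℝ) : {z | z ∈ WaveFront.shellAt H E A ∧
      z ∉ WaveFront.singularSet H I J E ∧ z ∉ WaveFront.causticSet (WaveFront.leaf H I J E z) ∧
      (I z, J z) = k}.Countable := by
    refine WaveFront.countable_of_isolated fun z hz => ?_
    obtain ⟨N, hN, hiso⟩ := WaveFront.isolated_of_notMem_causticSet h hH hz.1.1 hz.2.1 hz.2.2.1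
    exact ⟨N, hN, fun w hw hws => hiso w hw (hws.2.2.2.trans hz.2.2.2.symm)
      (hws.1.2.trans hz.1.2.symm)⟩
  refine ((hsing.union hcaustic.countable).union
    ((WaveFront.countable_moment_hyperbolicOrbits h hH hregular hMorseBott).biUnion
      fun k _ => hlevel k)).mono ?_
  rintro z ⟨hzA, hzZ⟩
  by_cases hzs : z ∈ WaveFront.singularSet H I J E
  · exact Or.inl (Or.inl ⟨hzA, hzs⟩)
  by_cases hzc : z ∈ WaveFront.causticSet (WaveFront.leaf H I J E z)
  · exact Or.inl (Or.inr ⟨⟨hzA, hzZ, hzs⟩, hzc⟩)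
  refine Or.inr ?_
  obtain ⟨γ, hγ, hzγ⟩ := mem_iUnion₂.1 (hzZ.resolve_left hzs)
  -- A point of the orbit supplies the moment value that indexes `z` in the countable union.
  obtain ⟨p, hp⟩ : γ.Nonempty := by
    obtain ⟨⟨c, _, _, _, _, rfl⟩, _⟩ := hγ
    exact range_nonempty c
  refine mem_iUnion₂.2 ⟨(I p, J p), ⟨p, ⟨γ, hγ, hp⟩, rfl⟩, hzA, hzs, hzc, ?_⟩
  rcases hzγ with ⟨c, hc, rfl, hl⟩ | ⟨c, hc, rfl, hl⟩
  · exact WaveFront.IsHyperbolicOrbit.moment_eq_of_tendsto hγ h hH hc hl hp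
  · exact WaveFront.IsHyperbolicOrbit.moment_eq_of_tendsto hγ h hH hc hl hp
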